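/- Let $\Sigma$ be a finite alphabet. A word $w\in\Sigma^*$ is a *pangram* over $\Sigma$ if every letter of $\Sigma$ occurs in $w$ at least once; let $P_\Sigma$ be the set of all pangrams over $\Sigma$. For a context-free grammar $g$ over $\Sigma$ (with finite sets of nonterminals and rules) let $L(g)\subseteq\Sigma^*$ be its language and let $|g|=\sum_{A\to\alpha}(1+|\alpha|)$, the sum being over the rules of $g$, be the number of symbol occurrences in its rules. **Theorem.** Given a finite alphabet $\Sigma$ and a context-free grammar $g$ over $\Sigma$, it is decidable in $O(|\Sigma|\cdot|g|)$ time whether $L(g)\subseteq P_\Sigma$. In detail: there are a single program $p$ of a word random access machine (constantly many registers and memory banks; indirect loads and stores, addition, truncated subtraction, comparisons, each at unit cost) and a constant $c$ such that, for every finite alphabet $\Sigma$ and every context-free grammar $g$ over $\Sigma$ with nonterminal set $N$, for every numbering of the letters and of the nonterminals and every ordering of the rules, the program $p$, started with the corresponding list of rules of $g$ in its memory and with words that hold the numbers $0,\dots,W$ for any $W\ge c\,(|\Sigma|+|N|+|g|+1)$, halts after at most $c\,(|\Sigma|\cdot|g|+1)$ steps without overflow, and it accepts (its output register contains $1$) if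 and only if $L(g)\subseteq P_\Sigma$. -/

import Mathlib

/-! ### Pangrams and the size of a context-free grammar -/

/-- The set `P_Σ` of all pangrams over the alphabet `T`: the words in which every letter occurs. -/
def pangrams (T : Type*) : Language T :=
  {w : List T | ∀ a : T, a ∈ w}

/-- The size of a context-free grammar: the number of symbol occurrences in its rules, where a rule
`A → α` contributes `1 + |α|`. -/
def ContextFreeGrammar.size {T : Type*} (g : ContextFreeGrammar T) : ℕ :=
  ∑ r ∈ g.rules, (1 + r.output.length)

/-! ### A word random access machine with a step count

A machine has registers `0, 1, 2, …` and memory banks `0, 1, 2, …`, each bank an array of words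
indexed by words. A program is a finite text, so it names only finitely many registers and banks;
a memory cell is accessed only through a register that holds its address. A word is a natural
number that is at most the word bound `W`. The only arithmetic is addition and truncated
subtraction, and an instruction whose result is not a word has no successor configuration. -/

namespace RAM

/-- Conditions on the contents of two registers. -/
inductive Test where
  /-- the first register is smaller than the second -/
  | lt (i j : ℕ)
  /-- the two registers are equal -/
  | eq (i j : ℕ)

/-- Programs. -/
inductive Program where
  /-- do nothing -/
  | skip
  /-- `R i := n` -/
  | const (i n : ℕ)
  /-- `R i := R j` -/
  | copy (i j : ℕ)
  /-- `R i := R j + R l` -/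
  | add (i j l : ℕ)
  /-- `R i := R j - R l` (zero if `R j < R l`) -/
  | sub (i j l : ℕ)
  /-- `R i := M b [R j]` -/
  | load (i b j : ℕ)
  /-- `M b [R j] := R i` -/
  | store (b j i : ℕ)
  /-- first `p`, then `q` -/
  | seq (p q : Program)
  /-- if `t` holds then `p`, else `q` -/
  | ite (t : Test) (p q : Program)
  /-- as long as `t` holds, `p` -/
  | loop (t : Test) (p : Program)

/-- The contents of the registers and of the memory banks. -/
structure Store where
  /-- `reg i` is the content of register `i` -/
  reg : ℕ → ℕ
  /-- `mem b a` is the content of the cell with address `a` in bank `b` -/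
  mem : ℕ → ℕ → ℕ

/-- Truth of a condition. -/
def Test.eval (s : Store) : Test → Bool
  | .lt i j => decide (s.reg i < s.reg j)
  | .eq i j => decide (s.reg i = s.reg j)

/-- The store in which register `i` has been set to `v`. -/
def Store.setReg (s : Store) (i v : ℕ) : Store :=
  { s with reg := Function.update s.reg i v }

/-- The store in which cell `a` of bank `b` has been set to `v`. -/
def Store.setMem (s : Store) (b a v : ℕ) : Store :=
  { s with mem := Function.update s.mem b (Function.update (s.mem b) a v) }

/-- A configuration: the subprograms that remain to be executed, in this order, and the store.
The machine has halted when nothing remains. -/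
structure Config where
  /-- the subprograms that remain to be executed -/
  todo : List Program
  /-- the current store -/
  store : Store

/-- One step of the machine with word bound `W`. There is none from a halted configuration, nor
after an arithmetic overflow. -/
def step (W : ℕ) : Config → Option Config
  | ⟨[], _⟩ => none
  | ⟨.skip :: k, s⟩ => some ⟨k, s⟩
  | ⟨.const i n :: k, s⟩ => if n ≤ W then some ⟨k, s.setReg i n⟩ else none
  | ⟨.copy i j :: k, s⟩ => some ⟨k, s.setReg i (s.reg j)⟩
  | ⟨.add i j l :: k, s⟩ =>
      if s.reg j + s.reg l ≤ W then some ⟨k, s.setReg i (s.reg j + s.reg l)⟩ else none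
  | ⟨.sub i j l :: k, s⟩ => some ⟨k, s.setReg i (s.reg j - s.reg l)⟩
  | ⟨.load i b j :: k, s⟩ => some ⟨k, s.setReg i (s.mem b (s.reg j))⟩
  | ⟨.store b j i :: k, s⟩ => some ⟨k, s.setMem b (s.reg j) (s.reg i)⟩
  | ⟨.seq p q :: k, s⟩ => some ⟨p :: q :: k, s⟩
  | ⟨.ite t p q :: k, s⟩ => some ⟨(if t.eval s then p else q) :: k, s⟩
  | ⟨.loop t p :: k, s⟩ => some ⟨if t.eval s then p :: .loop t p :: k else k, s⟩

/-- The configuration reached after exactly `n` steps, if there is one. -/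
def run (W : ℕ) : ℕ → Config → Option Config
  | 0, c => some c
  | n + 1, c => (step W c).bind (run W n)

/-- The initial store for the input `x`: bank `0` holds the entries of `x` at the addresses
`0, 1, 2, …`; all other cells and all registers hold `0`. -/
def Store.init (x : List ℕ) : Store where
  reg _ := 0
  mem b a := if b = 0 then x.getD a 0 else 0

/-- On input `x`, the program `p` with word bound `W` halts after at most `t` steps, with the final
store `s`. -/
def HaltsWithin (W : ℕ) (p : Program) (x : List ℕ) (t : ℕ) (s : Store) : Prop :=
  ∃ n ≤ t, run W n ⟨[p], Store.init x⟩ = some ⟨[], s⟩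

end RAM

/-! ### Context-free grammars as inputs of the machine -/

section encoding

variable {T N : Type*} {k m : ℕ}

/-- With the terminals numbered `0, …, k - 1` by `eT` and the nonterminals numbered `0, …, m - 1`
by `eN`, the code of a terminal is its number and that of a nonterminal is `k` plus its number. -/
def encodeSymbol (eT : T ≃ Fin k) (eN : N ≃ Fin m) : Symbol T N → ℕ
  | .terminal a => (eT a : ℕ)
  | .nonterminal A => k + (eN A : ℕ)

/-- The rule `A → α` is written as the number of `A`, the length of `α`, and the codes of the
symbols of `α`. -/
def encodeRule (eT : T ≃ Fin k) (eN : N ≃ Fin m) (r : ContextFreeRule T N) : List ℕ :=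
  (eN r.input : ℕ) :: r.output.length :: r.output.map (encodeSymbol eT eN)

/-- A grammar is written as the number of terminals, the number of nonterminals, the number of the
initial nonterminal, the number of rules, and the codes of the rules in the order of the list. -/
def encodeGrammar (eT : T ≃ Fin k) (eN : N ≃ Fin m) (initial : N)
    (rules : List (ContextFreeRule T N)) : List ℕ :=
  [k, m, (eN initial : ℕ), rules.length] ++ rules.flatMap (encodeRule eT eN)

end encoding

/-! ### A program logic with a step count -/

/-! A word of `L(g)` misses a letter `a` exactly when the initial nonterminal derives a word without
`a`. The nonterminals that derive such a word form the least set containing `A` whenever some rule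
`A → α` has no `a` in `α` and all nonterminals of `α` in the set (`Productive`). So the question is
one reachability problem of Horn type per letter, and each must be solved in time `O(|g|)`.

This is unit propagation. Every rule has a counter of its pending symbols: occurrences of `a`, which
are never discharged, and of nonterminals not yet treated. A rule whose counter is zero puts its
left side into a queue. Treating a nonterminal means walking through the list of its occurrences and
lowering the counters of the rules met. Each nonterminal enters the queue at most once and the
occurrence lists together are no longer than the grammar, so a round is linear (`work_le`,
`wp_drain`).

The bound has no term in the number of nonterminals, so no round may clear a table indexed by them.
Marks are therefore round numbers. The rounds count down, and a mark left by an earlier round is too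
large to be mistaken for a current one. The occurrence lists do not depend on the letter and are
built once (`wp_link`); the counters are recomputed in each round by a pass through the rules
(`wp_countPending`).

Time and absence of overflow are proved together with correctness, in a weakest precondition
calculus that carries a clock (`WP.sound`). A frame property saves restating what a subprogram
leaves alone. `language_le_pangrams_iff` links the propagation to derivations. -/

namespace RAM

/-- The weakest precondition of `p`: started in the store `s` at time `t`, the program halts without
overflow, and the time and the store at the end satisfy `Q`. For a loop, this is witnessed by an
invariant with a decreasing natural number. -/
def WP (W : ℕ) : Program → (ℕ → Store → Prop) → ℕ → Store → Prop
  | .skip, Q, t, s => Q (t + 1) s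
  | .const i n, Q, t, s => n ≤ W ∧ Q (t + 1) (s.setReg i n)
  | .copy i j, Q, t, s => Q (t + 1) (s.setReg i (s.reg j))
  | .add i j l, Q, t, s => s.reg j + s.reg l ≤ W ∧ Q (t + 1) (s.setReg i (s.reg j + s.reg l))
  | .sub i j l, Q, t, s => Q (t + 1) (s.setReg i (s.reg j - s.reg l))
  | .load i b j, Q, t, s => Q (t + 1) (s.setReg i (s.mem b (s.reg j)))
  | .store b j i, Q, t, s => Q (t + 1) (s.setMem b (s.reg j) (s.reg i))
  | .seq p q, Q, t, s => WP W p (WP W q Q) (t + 1) s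
  | .ite c p q, Q, t, s =>
      (c.eval s = true → WP W p Q (t + 1) s) ∧ (c.eval s = false → WP W q Q (t + 1) s)
  | .loop c p, Q, t, s => ∃ I : ℕ → ℕ → Store → Prop, (∃ n, I n t s) ∧ ∀ n t s, I n t s →
      (c.eval s = true → WP W p (fun t' s' => ∃ n' < n, I n' t' s') (t + 1) s) ∧
      (c.eval s = false → Q (t + 1) s)

theorem WP.mono {W : ℕ} {p : Program} {Q Q' : ℕ → Store → Prop} {t : ℕ} {s : Store}
    (h : WP W p Q t s) (hQ : ∀ t s, Q t s → Q' t s) : WP W p Q' t s := by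
  induction p generalizing Q Q' t s with
  | skip | copy | sub | load | store => exact hQ _ _ h
  | const | add => exact ⟨h.1, hQ _ _ h.2⟩
  | seq p q ihp ihq => exact ihp h fun _ _ h' => ihq h' hQ
  | ite c p q ihp ihq => exact ⟨fun hc => ihp (h.1 hc) hQ, fun hc => ihq (h.2 hc) hQ⟩
  | loop c p ih =>
    obtain ⟨I, h0, hI⟩ := h
    exact ⟨I, h0, fun n t s hn => ⟨(hI n t s hn).1, fun hc => hQ _ _ ((hI n t s hn).2 hc)⟩⟩

/-! ### Soundness of the calculus for the machine. -/

theorem run_add (W m n : ℕ) (c : Config) : run W (m + n) c = (run W m c).bind (run W n) := by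
  induction m generalizing c with
  | zero => simp [run]
  | succ m ih =>
    rw [Nat.succ_add]
    simp only [run]
    cases step W c with
    | none => rfl
    | some c' => simp [ih]

theorem run_trans {W m n : ℕ} {c c' c'' : Config} (h : run W m c = some c')
    (h' : run W n c' = some c'') : run W (m + n) c = some c'' := by
  rw [run_add, h]; exact h'

/-- The continuation `k` is arbitrary because the first half of a sequence, or a loop body, runs
with further programs waiting behind it. For a loop, a strong induction on the number carried by the
invariant sits inside the induction on programs. -/
theorem WP.sound {W : ℕ} {p : Program} {Q : ℕ → Store → Prop} {t : ℕ} {s : Store}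
    (h : WP W p Q t s) (k : List Program) :
    ∃ n s', run W n ⟨p :: k, s⟩ = some ⟨k, s'⟩ ∧ Q (t + n) s' := by
  induction p generalizing Q t s k with
  | skip | copy | sub | load | store => exact ⟨1, _, rfl, h⟩
  | const | add => exact ⟨1, _, by simp [run, step, h.1], h.2⟩
  | seq p q ihp ihq =>
    obtain ⟨n, s', hn, h'⟩ := ihp h (q :: k)
    obtain ⟨n', s'', hn', h''⟩ := ihq h' k
    refine ⟨1 + (n + n'), s'', run_trans rfl (run_trans hn hn'), ?_⟩
    simpa only [add_assoc] using h''
  | ite c p q ihp ihq =>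
    cases hc : c.eval s with
    | true =>
      obtain ⟨n, s', hn, h'⟩ := ihp (h.1 hc) k
      refine ⟨1 + n, s', run_trans (by simp [run, step, hc]) hn, ?_⟩
      simpa only [add_assoc] using h'
    | false =>
      obtain ⟨n, s', hn, h'⟩ := ihq (h.2 hc) k
      refine ⟨1 + n, s', run_trans (by simp [run, step, hc]) hn, ?_⟩
      simpa only [add_assoc] using h'
  | loop c p ih =>
    obtain ⟨I, ⟨f, h0⟩, hI⟩ := h
    induction f using Nat.strong_induction_on generalizing t s with
    | _ f ihf =>
      cases hc : c.eval s with
      | true =>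
        obtain ⟨n, s', hn, f', hf', h'⟩ := ih ((hI f t s h0).1 hc) (.loop c p :: k)
        obtain ⟨n', s'', hn', h''⟩ := ihf f' hf' h'
        refine ⟨1 + (n + n'), s'', run_trans (by simp [run, step, hc]) (run_trans hn hn'), ?_⟩
        simpa only [add_assoc] using h''
      | false => exact ⟨1, s, by simp [run, step, hc], (hI f t s h0).2 hc⟩

theorem WP.haltsWithin {W : ℕ} {p : Program} {x : List ℕ} {B : ℕ} {Q : Store → Prop}
    (h : WP W p (fun t s => t ≤ B ∧ Q s) 0 (Store.init x)) :
    ∃ s, HaltsWithin W p x B s ∧ Q s := by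
  obtain ⟨n, s, hn, hB, hs⟩ := h.sound []
  exact ⟨s, ⟨n, by omega, hn⟩, hs⟩

/-! ### The frame property. -/

/-- The registers that a program may write. -/
def Program.regs : Program → List ℕ
  | .skip | .store _ _ _ => []
  | .const i _ | .copy i _ | .add i _ _ | .sub i _ _ | .load i _ _ => [i]
  | .seq p q | .ite _ p q => p.regs ++ q.regs
  | .loop _ p => p.regs

/-- The memory banks that a program may write. -/
def Program.banks : Program → List ℕ
  | .store b _ _ => [b]
  | .seq p q | .ite _ p q => p.banks ++ q.banks
  | .loop _ p => p.banks
  | _ => []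

/-- The stores `s` and `s'` agree on all registers outside `l` and all banks outside `b`. -/
def Agree (l b : List ℕ) (s s' : Store) : Prop :=
  (∀ i ∉ l, s'.reg i = s.reg i) ∧ ∀ i ∉ b, s'.mem i = s.mem i

theorem Agree.refl (l b : List ℕ) (s : Store) : Agree l b s s := ⟨fun _ _ => rfl, fun _ _ => rfl⟩

theorem Agree.trans {l b l₁ b₁ l₂ b₂ : List ℕ} {s s' s'' : Store} (h : Agree l₁ b₁ s s')
    (h' : Agree l₂ b₂ s' s'') (hl₁ : l₁ ⊆ l) (hb₁ : b₁ ⊆ b) (hl₂ : l₂ ⊆ l) (hb₂ : b₂ ⊆ b) :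
    Agree l b s s'' :=
  ⟨fun i hi => (h'.1 i fun hi' => hi (hl₂ hi')).trans (h.1 i fun hi' => hi (hl₁ hi')),
    fun i hi => (h'.2 i fun hi' => hi (hb₂ hi')).trans (h.2 i fun hi' => hi (hb₁ hi'))⟩

theorem Agree.setReg (s : Store) (i v : ℕ) : Agree [i] [] s (s.setReg i v) :=
  ⟨fun j hj => by simp at hj; simp [Store.setReg, hj], fun _ _ => rfl⟩

theorem Agree.setMem (s : Store) (b a v : ℕ) : Agree [] [b] s (s.setMem b a v) :=
  ⟨fun _ _ => rfl, fun j hj => by simp at hj; simp [Store.setMem, hj]⟩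

/-- A program changes only the registers and banks that it writes. -/
theorem WP.frame {W : ℕ} {p : Program} {Q : ℕ → Store → Prop} {t : ℕ} {s : Store}
    (h : WP W p Q t s) : WP W p (fun t' s' => Q t' s' ∧ Agree p.regs p.banks s s') t s := by
  induction p generalizing Q t s with
  | skip => exact ⟨h, .refl _ _ _⟩
  | copy | sub | load => exact ⟨h, .setReg _ _ _⟩
  | store => exact ⟨h, .setMem _ _ _ _⟩
  | const | add => exact ⟨h.1, h.2, .setReg _ _ _⟩
  | seq p q ihp ihq =>
    refine (ihp h).mono fun t' s' h' => (ihq h'.1).mono fun t'' s'' h'' => ⟨h''.1, ?_⟩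
    exact h'.2.trans h''.2 (List.subset_append_left _ _) (List.subset_append_left _ _)
      (List.subset_append_right _ _) (List.subset_append_right _ _)
  | ite c p q ihp ihq =>
    exact ⟨fun hc => (ihp (h.1 hc)).mono fun _ _ h' => ⟨h'.1, h'.2.trans (.refl [] [] _)
        (List.subset_append_left _ _) (List.subset_append_left _ _) (by simp) (by simp)⟩,
      fun hc => (ihq (h.2 hc)).mono fun _ _ h' => ⟨h'.1, h'.2.trans (.refl [] [] _)
        (List.subset_append_right _ _) (List.subset_append_right _ _) (by simp) (by simp)⟩⟩
  | loop c p ih =>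
    obtain ⟨I, ⟨f, h0⟩, hI⟩ := h
    -- The loop invariant is strengthened by agreement with the store before the whole loop, not
    -- with that of the previous iteration.
    refine ⟨fun n t s' => I n t s' ∧ Agree p.regs p.banks s s', ⟨f, h0, .refl _ _ _⟩,
      fun n t s' hn => ⟨fun hc => (ih ((hI n t s' hn.1).1 hc)).mono ?_,
        fun hc => ⟨(hI n t s' hn.1).2 hc, hn.2⟩⟩⟩
    rintro t'' s'' ⟨⟨n', hn', h'⟩, h''⟩
    exact ⟨n', hn', h', hn.2.trans h'' (by simp) (by simp) (by simp) (by simp)⟩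

theorem WP.frame_of_subset {W : ℕ} {p : Program} {Q : ℕ → Store → Prop} {t : ℕ} {s : Store}
    (h : WP W p Q t s) {l b : List ℕ} (hl : p.regs ⊆ l) (hb : p.banks ⊆ b) :
    WP W p (fun t' s' => Q t' s' ∧ Agree l b s s') t s :=
  h.frame.mono fun _ s' h' => ⟨h'.1, h'.2.trans (.refl [] [] s') hl hb (by simp) (by simp)⟩

/-! ### Rules of the calculus for single instructions. -/

section

variable {W : ℕ} {Q : ℕ → Store → Prop} {t : ℕ} {s : Store}

theorem wp_skip : WP W .skip Q t s ↔ Q (t + 1) s := .rfl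

theorem wp_const {i n : ℕ} : WP W (.const i n) Q t s ↔ n ≤ W ∧ Q (t + 1) (s.setReg i n) := .rfl

theorem wp_copy {i j : ℕ} : WP W (.copy i j) Q t s ↔ Q (t + 1) (s.setReg i (s.reg j)) := .rfl

theorem wp_add {i j l : ℕ} : WP W (.add i j l) Q t s ↔
    s.reg j + s.reg l ≤ W ∧ Q (t + 1) (s.setReg i (s.reg j + s.reg l)) := .rfl

theorem wp_sub {i j l : ℕ} :
    WP W (.sub i j l) Q t s ↔ Q (t + 1) (s.setReg i (s.reg j - s.reg l)) := .rfl

theorem wp_load {i b j : ℕ} :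
    WP W (.load i b j) Q t s ↔ Q (t + 1) (s.setReg i (s.mem b (s.reg j))) := .rfl

theorem wp_store {b j i : ℕ} :
    WP W (.store b j i) Q t s ↔ Q (t + 1) (s.setMem b (s.reg j) (s.reg i)) := .rfl

theorem wp_seq {p q : Program} : WP W (.seq p q) Q t s ↔ WP W p (WP W q Q) (t + 1) s := .rfl

theorem wp_ite_lt {i j : ℕ} {p q : Program} : WP W (.ite (.lt i j) p q) Q t s ↔
    (s.reg i < s.reg j → WP W p Q (t + 1) s) ∧ (s.reg j ≤ s.reg i → WP W q Q (t + 1) s) := by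
  simp [WP, Test.eval]

theorem wp_ite_eq {i j : ℕ} {p q : Program} : WP W (.ite (.eq i j) p q) Q t s ↔
    (s.reg i = s.reg j → WP W p Q (t + 1) s) ∧ (s.reg i ≠ s.reg j → WP W q Q (t + 1) s) := by
  simp [WP, Test.eval]

/-- A loop whose invariant `I` carries a natural number that decreases. -/
theorem wp_loop_lt {i j : ℕ} {p : Program} (I : ℕ → ℕ → Store → Prop) {n : ℕ} (h : I n t s)
    (hI : ∀ n t s, I n t s → s.reg i < s.reg j →
      WP W p (fun t' s' => ∃ n' < n, I n' t' s') (t + 1) s)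
    (hQ : ∀ n t s, I n t s → s.reg j ≤ s.reg i → Q (t + 1) s) : WP W (.loop (.lt i j) p) Q t s :=
  ⟨I, ⟨n, h⟩, fun n t s hn => ⟨fun hc => hI n t s hn (by simpa [Test.eval] using hc),
    fun hc => hQ n t s hn (by simpa [Test.eval] using hc)⟩⟩

@[simp]
theorem Store.reg_setReg (s : Store) (i v j : ℕ) :
    (s.setReg i v).reg j = if j = i then v else s.reg j := Function.update_apply _ _ _ _

@[simp]
theorem Store.mem_setReg (s : Store) (i v : ℕ) : (s.setReg i v).mem = s.mem := rfl

@[simp]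
theorem Store.reg_setMem (s : Store) (b a v : ℕ) : (s.setMem b a v).reg = s.reg := rfl

@[simp]
theorem Store.mem_setMem (s : Store) (b a v b' : ℕ) : (s.setMem b a v).mem b' =
    if b' = b then Function.update (s.mem b) a v else s.mem b' := Function.update_apply _ _ _ _

end

/-! ### Rules in memory -/

/-- A rule whose code begins at the address `addr`. -/
structure Entry where
  /-- the address of the rule -/
  addr : ℕ
  /-- the number of the nonterminal on the left -/
  lhs : ℕ
  /-- the codes of the symbols on the right -/
  rhs : List ℕ

/-- The number of cells that the codes of rules occupy. -/
def extent (R : List Entry) : ℕ := (R.map fun r => 2 + r.rhs.length).sum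

@[simp]
theorem extent_nil : extent [] = 0 := rfl

@[simp]
theorem extent_cons (r : Entry) (R : List Entry) :
    extent (r :: R) = 2 + r.rhs.length + extent R := rfl

@[simp]
theorem extent_append (R R' : List Entry) : extent (R ++ R') = extent R + extent R' := by
  simp [extent]

theorem length_le_extent (R : List Entry) : R.length ≤ extent R := by
  induction R with
  | nil => simp
  | cons r R ih => simp; omega

theorem length_flatMap_rhs_le_extent (R : List Entry) :
    (R.flatMap Entry.rhs).length ≤ extent R := by
  induction R with
  | nil => simp
  | cons r R ih => simp at ih ⊢; omega

/-- The codes of the rules `R` stand in the bank `x`, one after the other from address `4` on. -/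
def Placed (x : ℕ → ℕ) (R : List Entry) : Prop :=
  ∀ done r rest, R = done ++ r :: rest → r.addr = 4 + extent done ∧ x r.addr = r.lhs ∧
    x (r.addr + 1) = r.rhs.length ∧ ∀ u c v, r.rhs = u ++ c :: v → x (r.addr + 2 + u.length) = c

theorem Placed.left {x : ℕ → ℕ} {R R' : List Entry} (h : Placed x (R ++ R')) : Placed x R :=
  fun done r rest hR => h done r (rest ++ R') (by simp [hR])

theorem Placed.eq_lhs {x : ℕ → ℕ} {R : List Entry} (h : Placed x R) {r : Entry} (hr : r ∈ R) :
    x r.addr = r.lhs := by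
  obtain ⟨done, rest, rfl⟩ := List.append_of_mem hr
  exact (h done r rest rfl).2.1

theorem Placed.addr_lt {x : ℕ → ℕ} {R : List Entry} (h : Placed x R) {r : Entry} (hr : r ∈ R) :
    r.addr + 2 + r.rhs.length ≤ 4 + extent R := by
  obtain ⟨done, rest, rfl⟩ := List.append_of_mem hr
  have := (h done r rest rfl).1
  simp; omega

theorem Placed.addr_ne {x : ℕ → ℕ} {done rest : List Entry} {r : Entry}
    (h : Placed x (done ++ r :: rest)) {r' : Entry} (hr : r' ∈ done) : r'.addr ≠ r.addr := by
  have h₁ := (h done r rest rfl).1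
  have h₂ := h.left.addr_lt hr
  omega

/-! ### Passing through the rules

The registers of the programs below hold: `0` the answer, `1` one, `2` zero, `3` the number of
letters, `4` the number of rules, `5` the number of rules still to be read, `6` the address of a
rule, `7` the code of its left side, `8` the address of a symbol, `9` the end of the right side,
`10` the code of a symbol, `11` the number of the round, `12` the number of its letter, `13` a
counter, `14` a mark, `15` and `16` the end and the front of the queue, `17` the code of the initial
nonterminal. The memory banks hold: `0` the input, `1` the first cell of the occurrence list of
every symbol, `2` the links of these lists, `3` the rules in which the occurrences are, `4` the
number of pending symbols of every rule, `5` the marks of the nonterminals, `6` the queue. -/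

/-- For every rule, with its address in register `6`, first set register `13` to zero, then execute
`body` for every symbol of its right side, with the address of the symbol in register `8` and its
code in register `10`, and finally execute `post`. Registers `1`, `2` and `4` hold one, zero and
the number of rules. -/
def scan (body post : Program) : Program :=
  .seq (.copy 5 4) <| .seq (.const 6 4) <| .loop (.lt 2 5) <|
    .seq (.add 8 6 1) <| .seq (.load 9 0 8) <| .seq (.add 8 8 1) <| .seq (.add 9 9 8) <|
    .seq (.const 13 0) <|
    .seq (.loop (.lt 8 9) (.seq (.load 10 0 8) (.seq body (.add 8 8 1)))) <|
    .seq post <| .seq (.copy 6 9) (.sub 5 5 1)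

/-- The registers that a pass through the rules may write. -/
abbrev scanRegs : List ℕ := [5, 6, 7, 8, 9, 10, 13, 14, 15]

/-- `I` is the invariant between rules, `J` the one inside a rule after the symbols `u`. Both see
only the memory, the end of the queue and, for `J`, the counter; everything else follows from
`Agree`. As `body` and `post` may write only registers 7, 13, 14 and 15, the loop control survives
them. With 20 steps allowed for each, a symbol costs at most 30 steps, and the rest of a rule is
covered by the 100 steps that its two header cells contribute. -/
theorem wp_scan {W : ℕ} {body post : Program} {R : List Entry} {x : ℕ → ℕ} {B : List ℕ}
    {s : Store} {t : ℕ} (I : List Entry → (ℕ → ℕ → ℕ) → ℕ → Prop)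
    (J : List Entry → Entry → List ℕ → (ℕ → ℕ → ℕ) → ℕ → ℕ → Prop)
    (hbr : body.regs ⊆ [7, 13, 14, 15]) (hpr : post.regs ⊆ [7, 13, 14, 15])
    (hbb : body.banks ⊆ B) (hpb : post.banks ⊆ B) (hB : 0 ∉ B)
    (hR : Placed x R) (hW : 4 + extent R ≤ W)
    (h1 : s.reg 1 = 1) (h2 : s.reg 2 = 0) (h4 : s.reg 4 = R.length) (h0 : s.mem 0 = x)
    (enter : ∀ done r rest, R = done ++ r :: rest → ∀ m tl, I done m tl → J done r [] m tl 0)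
    (hbody : ∀ done r rest, R = done ++ r :: rest → ∀ u c v, r.rhs = u ++ c :: v → ∀ t s',
      Agree scanRegs B s s' → s'.reg 6 = r.addr → s'.reg 8 = r.addr + 2 + u.length →
      s'.reg 10 = c → J done r u s'.mem (s'.reg 15) (s'.reg 13) →
      WP W body (fun t' s'' => t' ≤ t + 20 ∧ J done r (u ++ [c]) s''.mem (s''.reg 15) (s''.reg 13))
        t s')
    (hpost : ∀ done r rest, R = done ++ r :: rest → ∀ t s',
      Agree scanRegs B s s' → s'.reg 6 = r.addr →
      J done r r.rhs s'.mem (s'.reg 15) (s'.reg 13) →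
      WP W post (fun t' s'' => t' ≤ t + 20 ∧ I (done ++ [r]) s''.mem (s''.reg 15)) t s')
    (hI : I [] s.mem (s.reg 15)) :
    WP W (scan body post)
      (fun t' s' => t' ≤ t + 50 * extent R + 10 ∧ I R s'.mem (s'.reg 15)) t s := by
  simp only [scan, wp_seq, wp_copy, wp_const]
  refine ⟨by omega, ?_⟩
  refine wp_loop_lt (n := R.length) (fun n t' s' => ∃ done rest, R = done ++ rest ∧
    rest.length = n ∧ s'.reg 5 = n ∧ s'.reg 6 = 4 + extent done ∧ Agree scanRegs B s s' ∧
    t' ≤ t + 50 * extent done + 5 ∧ I done s'.mem (s'.reg 15)) ?_ ?_ ?_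
  · refine ⟨[], R, rfl, rfl, by simp [h4], by simp, ?_, by simp, by simpa using hI⟩
    exact ((Agree.setReg _ _ _).trans (Agree.setReg _ _ _) (l := scanRegs) (b := B)
      (by simp) (by simp) (by simp) (by simp))
  · rintro n t₁ s₁ ⟨done, rest, hdr, hn, h5, h6, ha, ht, hi⟩ hlt
    have e1 : s₁.reg 1 = 1 := by rw [ha.1 1 (by simp), h1]
    have e2 : s₁.reg 2 = 0 := by rw [ha.1 2 (by simp), h2]
    have e0 : s₁.mem 0 = x := by rw [ha.2 0 hB, h0]
    obtain _ | ⟨r, rest⟩ := rest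
    · simp at hn; omega
    obtain ⟨ra, rl, rlen, rsym⟩ := hR done r rest hdr
    have hrW := hR.addr_lt (r := r) (by simp [hdr])
    simp only [wp_seq, wp_add, wp_load, wp_const, Store.reg_setReg, Store.mem_setReg, e1, e0, h6,
      ← ra, reduceIte, Nat.reduceEqDiff, rlen]
    refine ⟨by omega, by omega, by omega, by omega, ?_⟩
    refine wp_loop_lt (n := r.rhs.length) (fun n t' s' => ∃ u v, r.rhs = u ++ v ∧ v.length = n ∧
      s'.reg 5 = rest.length + 1 ∧ s'.reg 6 = r.addr ∧ s'.reg 8 = r.addr + 2 + u.length ∧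
      s'.reg 9 = r.addr + 2 + r.rhs.length ∧ Agree scanRegs B s s' ∧
      t' ≤ t + 50 * extent done + 20 + 30 * u.length ∧
      J done r u s'.mem (s'.reg 15) (s'.reg 13)) ?_ ?_ ?_
    · refine ⟨[], r.rhs, rfl, rfl, ?_, ?_, ?_, ?_, ?_, ?_, ?_⟩
      · simpa [h5] using hn.symm
      · simp [h6, ra]
      · simp
      · simp; omega
      · refine ha.trans (l₂ := [8, 9, 13]) (b₂ := []) ?_ (by simp) (by simp) (by simp) (by simp)
        exact ⟨fun i hi => by simp at hi; simp [hi], fun _ _ => rfl⟩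
      · simp; omega
      · simpa using enter done r rest hdr _ _ hi
    · rintro n' t₂ s₂ ⟨u, v, huv, hv, g5, g6, g8, g9, ga, gt, gj⟩ glt
      have e0 : s₂.mem 0 = x := by rw [ga.2 0 hB, h0]
      obtain _ | ⟨c, v⟩ := v
      · simp at huv; rw [huv] at g9; omega
      have hc := rsym u c v huv
      simp only [wp_seq, wp_load, e0, g8, hc]
      have hag : Agree scanRegs B s (s₂.setReg 10 c) :=
        ga.trans (Agree.setReg _ _ _) (by simp) (by simp) (by simp) (by simp)
      refine ((hbody done r rest hdr u c v huv _ _ hag (by simpa using g6) (by simpa using g8)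
        (by simp) (by simpa using gj)).frame_of_subset hbr hbb).mono ?_
      rintro t₃ s₃ ⟨⟨kt, kj⟩, ka⟩
      have k8 : s₃.reg 8 = r.addr + 2 + u.length := by rw [ka.1 8 (by simp)]; simpa using g8
      have k1 : s₃.reg 1 = 1 := by rw [ka.1 1 (by simp)]; simpa using (ga.1 1 (by simp)).trans h1
      have hlen : r.rhs.length = u.length + (v.length + 1) := by simp [huv]
      refine wp_add.2 ⟨by omega, v.length, by simp at hv; omega, u ++ [c], v, by simp [huv], rfl,
        ?_, ?_, ?_, ?_, ?_, ?_, ?_⟩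
      · simp [ka.1 5, g5]
      · simp [ka.1 6, g6]
      · simp [k1, k8]; omega
      · simp [ka.1 9, g9]
      · refine (hag.trans ka (l := scanRegs) (b := B) (by simp) (by simp) (by simp) (by simp)).trans
          (Agree.setReg _ _ _) (by simp) (by simp) (by simp) (by simp)
      · simp; omega
      · simpa using kj
    · rintro n' t₂ s₂ ⟨u, v, huv, hv, g5, g6, g8, g9, ga, gt, gj⟩ glt
      have hlen : r.rhs.length = u.length + v.length := by simp [huv]
      obtain rfl : v = [] := List.length_eq_zero_iff.1 (by omega)
      obtain rfl : u = r.rhs := by simpa using huv.symm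
      rw [wp_seq]
      refine ((hpost done r rest hdr _ s₂ ga g6 gj).frame_of_subset hpr hpb).mono ?_
      rintro t₃ s₃ ⟨⟨kt, kj⟩, ka⟩
      have k9 := ka.1 9 (by simp)
      have k5 := ka.1 5 (by simp)
      have k1 : s₃.reg 1 = 1 := by rw [ka.1 1 (by simp)]; simpa using (ga.1 1 (by simp)).trans h1
      simp only [wp_seq, wp_copy, wp_sub]
      refine ⟨rest.length, by simp at hn; omega, done ++ [r], rest, by simp [hdr], rfl, ?_, ?_, ?_,
        ?_, ?_⟩
      · simp [k5, g5, k1]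
      · simp [k9, g9, ra]; omega
      · refine (ga.trans ka (l := scanRegs) (b := B) (by simp) (by simp) (by simp) (by simp)).trans
          (l₂ := [5, 6]) (b₂ := []) ?_ (by simp) (by simp) (by simp) (by simp)
        exact ⟨fun i hi => by simp at hi; simp [hi], fun _ _ => rfl⟩
      · simp; omega
      · simpa using kj
  · rintro n t₁ s₁ ⟨done, rest, hdr, hn, h5, h6, ha, ht, hi⟩ hle
    have e2 : s₁.reg 2 = 0 := by rw [ha.1 2 (by simp), h2]
    obtain rfl : rest = [] := List.length_eq_zero_iff.1 (by omega)
    obtain rfl : R = done := by simpa using hdr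
    exact ⟨by omega, hi⟩

/-! ### Occurrence lists -/

/-- `l` is the list of values of `v` along the path of decreasing links `nx` that starts in
`h < b` and ends in `0`. -/
def Chain (nx v : ℕ → ℕ) : ℕ → ℕ → List ℕ → Prop
  | _, h, [] => h = 0
  | b, h, q :: l => 0 < h ∧ h < b ∧ v h = q ∧ Chain nx v h (nx h) l

/-- Links decrease, so a list that starts below `b` never looks at a cell from `b` on; writing there
cannot damage it. -/
theorem Chain.mono {nx v nx' v' : ℕ → ℕ} {b b' h : ℕ} {l : List ℕ} (hc : Chain nx v b h l)
    (hb : b ≤ b') (hn : ∀ i < b, nx' i = nx i) (hv : ∀ i < b, v' i = v i) :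
    Chain nx' v' b' h l := by
  induction l generalizing b b' h with
  | nil => exact hc
  | cons q l ih =>
    obtain ⟨h0, hlt, hq, hc⟩ := hc
    refine ⟨h0, by omega, by rw [hv h hlt, hq], ?_⟩
    rw [hn h hlt]
    exact ih hc le_rfl (fun i hi => hn i (by omega)) (fun i hi => hv i (by omega))

/-- The addresses of the rules in whose right sides the symbol `c` occurs, with multiplicity, last
occurrence first. -/
def occurrences (R : List Entry) (c : ℕ) : List ℕ :=
  (R.flatMap fun r => List.replicate (r.rhs.count c) r.addr).reverse

theorem occurrences_concat (R : List Entry) (r : Entry) (c : ℕ) :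
    occurrences (R ++ [r]) c = List.replicate (r.rhs.count c) r.addr ++ occurrences R c := by
  simp [occurrences]

theorem length_occurrences (R : List Entry) (c : ℕ) :
    (occurrences R c).length = (R.flatMap Entry.rhs).count c := by
  induction R with
  | nil => rfl
  | cons r R ih => simp [occurrences, List.count_append] at ih ⊢; omega

theorem exists_of_mem_occurrences {R : List Entry} {c q : ℕ} (h : q ∈ occurrences R c) :
    ∃ r ∈ R, r.addr = q := by
  simp only [occurrences, List.mem_reverse, List.mem_flatMap, List.mem_replicate] at h
  obtain ⟨r, hr, -, rfl⟩ := h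
  exact ⟨r, hr, rfl⟩

/-- Different positions in the list of rules have different addresses, so no other rule contributes
to the count. -/
theorem count_occurrences {x : ℕ → ℕ} {R : List Entry} (hR : Placed x R) {r : Entry} (hr : r ∈ R)
    (c : ℕ) : (occurrences R c).count r.addr = r.rhs.count c := by
  induction R using List.reverseRecOn with
  | nil => simp at hr
  | append_singleton R r' ih =>
    rw [occurrences_concat, List.count_append]
    by_cases hr' : r ∈ R
    · have := hR.addr_ne hr'
      rw [ih hR.left hr', List.count_replicate]
      simp [Ne.symm this]
    · obtain rfl : r = r' := by simpa [hr'] using hr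
      have : (occurrences R c).count r.addr = 0 := by
        refine List.count_eq_zero.2 fun hq => ?_
        obtain ⟨r', h', he⟩ := exists_of_mem_occurrences hq
        exact hR.addr_ne h' he
      simp [this]

/-- Insert the address in register `8` into the list of the symbol in register `10`, with the
address of its rule, which is in register `6`. -/
def linkBody : Program :=
  .seq (.load 13 1 10) <| .seq (.store 2 8 13) <| .seq (.store 3 8 6) (.store 1 10 8)

/-- Build the occurrence lists of all symbols. -/
def link : Program := scan linkBody .skip

/-- The memory `m` holds, for every symbol, the list of its occurrences in `R`. -/
def Linked (R : List Entry) (m : ℕ → ℕ → ℕ) : Prop :=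
  ∀ c, Chain (m 2) (m 3) (4 + extent R) (m 1 c) (occurrences R c)

theorem wp_link {W : ℕ} {R : List Entry} {x : ℕ → ℕ} {s : Store} {t : ℕ}
    (hR : Placed x R) (hW : 4 + extent R ≤ W)
    (h1 : s.reg 1 = 1) (h2 : s.reg 2 = 0) (h4 : s.reg 4 = R.length) (h0 : s.mem 0 = x)
    (hm : ∀ c, s.mem 1 c = 0) :
    WP W link (fun t' s' => t' ≤ t + 50 * extent R + 10 ∧ Linked R s'.mem) t s := by
  refine wp_scan (B := [1, 2, 3]) (fun done m _ => Linked done m)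
    (fun done r u m _ _ => ∀ c, Chain (m 2) (m 3) (r.addr + 2 + u.length) (m 1 c)
      (List.replicate (u.count c) r.addr ++ occurrences done c))
    (by simp [linkBody, Program.regs]) (by simp [Program.regs])
    (by simp [linkBody, Program.banks]) (by simp [Program.banks]) (by simp)
    hR hW h1 h2 h4 h0 ?_ ?_ ?_ ?_
  · intro done r rest hd m tl hL c
    have := (hR done r rest hd).1
    simpa using (hL c).mono (by omega) (fun _ _ => rfl) (fun _ _ => rfl)
  · intro done r rest hd u c v hu t s' ha h6 h8 h10 hJ
    have ra := (hR done r rest hd).1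
    simp only [linkBody, wp_seq, wp_load, wp_store, Store.reg_setReg, Store.mem_setReg,
      Store.reg_setMem, Store.mem_setMem, reduceIte, Nat.reduceEqDiff, h6, h8, h10]
    refine ⟨by omega, fun c' => ?_⟩
    -- The cell written is the one at the address of the current symbol, which is the strict upper
    -- bound of all lists built so far. They stay intact, and the new head lies above the old one.
    have hlt : ∀ (f : ℕ → ℕ) (w i), i < r.addr + 2 + u.length →
        Function.update f (r.addr + 2 + u.length) w i = f i :=
      fun f w i hi => Function.update_of_ne (by omega) _ _
    have key := (hJ c').mono (b' := r.addr + 2 + u.length) le_rfl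
      (hlt (s'.mem 2) (s'.mem 1 c)) (hlt (s'.mem 3) r.addr)
    by_cases hc : c' = c
    · subst hc
      rw [List.count_append, List.count_singleton_self, List.replicate_succ,
        List.cons_append]
      refine ⟨by simp, by simp, by simp, ?_⟩
      simpa using key
    · rw [List.count_append, List.count_singleton, if_neg (by simpa using Ne.symm hc),
        Function.update_of_ne hc]
      exact key.mono (by simp) (fun _ _ => rfl) (fun _ _ => rfl)
  · intro done r rest hd t s' ha h6 hJ
    have ra := (hR done r rest hd).1
    refine wp_skip.2 ⟨by omega, fun c => ?_⟩
    rw [occurrences_concat]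
    exact (hJ c).mono (by simp; omega) (fun _ _ => rfl) (fun _ _ => rfl)
  · intro c
    exact hm c

/-! ### Productive nonterminals -/

/-- The codes of the nonterminals from which a word without the letter `a` can be derived, where
the codes below `k` are those of letters. -/
inductive Productive (R : List Entry) (k a : ℕ) : ℕ → Prop
  | intro (r : Entry) (hr : r ∈ R) (ha : ∀ c ∈ r.rhs, c ≠ a)
      (h : ∀ c ∈ r.rhs, k ≤ c → Productive R k a c) : Productive R k a (k + r.lhs)

theorem Productive.le {R : List Entry} {k a c : ℕ} (h : Productive R k a c) : k ≤ c := by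
  obtain ⟨r⟩ := h; omega

/-! ### Pending symbols and the queue. -/

/-- The number of occurrences in `l` of the letter `a` and of nonterminals outside `P`. -/
def pending (k a : ℕ) (P l : List ℕ) : ℕ :=
  l.countP fun c => decide (c = a ∨ k ≤ c ∧ c ∉ P)

theorem pending_eq_zero {k a : ℕ} {P l : List ℕ} :
    pending k a P l = 0 ↔ ∀ c ∈ l, c ≠ a ∧ (k ≤ c → c ∈ P) := by
  simp only [pending, List.countP_eq_zero, decide_eq_true_eq]
  refine forall₂_congr fun c _ => ?_
  tauto

/-- Since `a < k ≤ c`, the symbol `c` is not the forbidden letter. Its occurrences were counted only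
because `c ∉ P`, and all of them cease to be pending once `c` is treated. -/
theorem pending_concat {k a c : ℕ} {P : List ℕ} (l : List ℕ) (ha : a < k) (hc : k ≤ c)
    (hP : c ∉ P) : pending k a P l = pending k a (P ++ [c]) l + l.count c := by
  induction l with
  | nil => rfl
  | cons d l ih =>
    simp only [pending, List.countP_cons, List.count_cons] at ih ⊢
    rw [ih]
    by_cases hd : d = c
    · subst hd
      have : d ≠ a := by omega
      simp [hc, hP, this]; omega
    · simp [hd]; omega

/-- The queue `Q`, of length `tl`, contains productive nonterminals without repetition, and exactly
those are marked with the number `j` of the round. -/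
structure Queue (R : List Entry) (k a j : ℕ) (m : ℕ → ℕ → ℕ) (tl : ℕ) (Q : List ℕ) : Prop where
  nodup : Q.Nodup
  length : tl = Q.length
  get : ∀ i (h : i < Q.length), m 6 i = Q[i]
  mark : ∀ c, m 5 c = j ↔ c ∈ Q
  -- Rounds count down, so at the start of the next round every nonzero mark exceeds its number and
  -- nothing has to be erased.
  stale : ∀ c, m 5 c = 0 ∨ j ≤ m 5 c
  productive : ∀ c ∈ Q, Productive R k a c

/-- A productive nonterminal is the left side of a rule. This bounds the queue by the number of
rules instead of the number of nonterminals, for the time as well as for the word size. -/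
theorem Queue.length_le {R : List Entry} {k a j tl : ℕ} {m : ℕ → ℕ → ℕ} {Q : List ℕ}
    (h : Queue R k a j m tl Q) : Q.length ≤ R.length := by
  have : Q ⊆ R.map fun r => k + r.lhs := fun c hc => by
    obtain ⟨r, hr⟩ := h.productive c hc
    exact List.mem_map.2 ⟨r, hr, rfl⟩
  simpa using (h.nodup.subperm this).length_le

/-- If register `13` holds zero, enqueue the left side of the rule at the address in register `6`,
unless it is marked. -/
def fire : Program :=
  .ite (.eq 13 2) (.seq (.load 7 0 6) <| .seq (.add 7 7 3) <| .seq (.load 14 5 7) <|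
    .ite (.eq 14 11) .skip (.seq (.store 5 7 11) <| .seq (.store 6 15 7) (.add 15 15 1))) .skip

/-- The test of the mark keeps the queue free of repetitions. The old queue is a prefix of the new
one, so entries already treated keep their positions. -/
theorem wp_fire {W : ℕ} {R : List Entry} {x : ℕ → ℕ} {k a j : ℕ} {Q : List ℕ} {r : Entry}
    {s : Store} {t : ℕ} (hR : Placed x R) (hr : r ∈ R)
    (hW : 4 + extent R ≤ W) (hlhs : k + r.lhs ≤ W)
    (h1 : s.reg 1 = 1) (h2 : s.reg 2 = 0) (h3 : s.reg 3 = k) (h11 : s.reg 11 = j)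
    (h0 : s.mem 0 = x) (h6 : s.reg 6 = r.addr) (hQ : Queue R k a j s.mem (s.reg 15) Q)
    (hp : s.reg 13 = 0 → Productive R k a (k + r.lhs)) :
    WP W fire (fun t' s' => t' ≤ t + 14 ∧ ∃ Q', Q <+: Q' ∧ Queue R k a j s'.mem (s'.reg 15) Q' ∧
      (s.reg 13 = 0 → k + r.lhs ∈ Q')) t s := by
  have hl := hQ.length_le
  have hl' := length_le_extent R
  simp only [fire, wp_ite_eq, wp_seq, wp_load, wp_store, wp_add, wp_skip, Store.reg_setReg,
    Store.mem_setReg, Store.reg_setMem, reduceIte, Nat.reduceEqDiff, h1, h2, h3, h6,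
    h11, h0, hR.eq_lhs hr]
  rw [add_comm r.lhs]
  refine ⟨fun hz => ⟨hlhs, fun hm => ?_, fun hm => ⟨?_, ?_⟩⟩, fun hz => ?_⟩
  · exact ⟨by omega, Q, List.prefix_rfl, hQ, fun _ => (hQ.mark _).1 hm⟩
  · rw [hQ.length]; omega
  · have hnot : k + r.lhs ∉ Q := fun h => hm ((hQ.mark _).2 h)
    refine ⟨by omega, Q ++ [k + r.lhs], List.prefix_append _ _, ?_, fun _ => by simp⟩
    refine ⟨?_, ?_, ?_, ?_, ?_, ?_⟩
    · exact List.nodup_append.2 ⟨hQ.nodup, by simp, by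
        rintro c hc d hd rfl
        exact hnot (by simpa [List.mem_singleton.1 hd] using hc)⟩
    · simp [hQ.length]
    · intro i hi
      simp only [List.length_append, List.length_singleton] at hi
      by_cases hi' : i < Q.length
      · simp [hQ.length, hi'.ne, List.getElem_append_left hi', hQ.get i hi']
      · obtain rfl : i = Q.length := by omega
        simp [hQ.length]
    · intro c
      by_cases hc : c = k + r.lhs
      · simp [hc]
      · simp [hc, hQ.mark]
    · intro c
      by_cases hc : c = k + r.lhs
      · simp [hc]
      · simp [Function.update_of_ne hc, hQ.stale]
    · intro c hc
      rcases List.mem_append.1 hc with hc | hc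
      · exact hQ.productive c hc
      · rw [List.mem_singleton.1 hc]; exact hp hz
  · exact ⟨by omega, Q, List.prefix_rfl, hQ, fun h => absurd h hz⟩

/-! ### One round -/

/-- Count the symbol in register `10` if it is the letter in register `12` or a nonterminal. -/
def countBody : Program :=
  .ite (.lt 10 3) (.ite (.eq 10 12) (.add 13 13 1) .skip) (.add 13 13 1)

/-- Store the pending symbols of every rule, and enqueue the left sides of rules without any. -/
def countPending : Program := scan countBody (.seq (.store 4 6 13) fire)

/-- This sets up the invariant of the propagation for the empty set of treated nonterminals: rules
without pending symbols have already fired. -/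
theorem wp_countPending {W : ℕ} {R : List Entry} {x : ℕ → ℕ} {k a j : ℕ} {s : Store} {t : ℕ}
    (hR : Placed x R) (hW : 4 + extent R ≤ W) (hlhs : ∀ r ∈ R, k + r.lhs ≤ W)
    (h1 : s.reg 1 = 1) (h2 : s.reg 2 = 0) (h3 : s.reg 3 = k) (h4 : s.reg 4 = R.length)
    (h11 : s.reg 11 = j) (h12 : s.reg 12 = a)
    (h0 : s.mem 0 = x) (hQ : Queue R k a j s.mem (s.reg 15) []) :
    WP W countPending (fun t' s' => t' ≤ t + 50 * extent R + 10 ∧ ∃ Q,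
      Queue R k a j s'.mem (s'.reg 15) Q ∧ ∀ r ∈ R, s'.mem 4 r.addr = pending k a [] r.rhs ∧
        (pending k a [] r.rhs = 0 → k + r.lhs ∈ Q)) t s := by
  refine wp_scan (B := [4, 5, 6])
    (fun done m tl => ∃ Q, Queue R k a j m tl Q ∧ ∀ r ∈ done, m 4 r.addr = pending k a [] r.rhs ∧
      (pending k a [] r.rhs = 0 → k + r.lhs ∈ Q))
    (fun done r u m tl cnt => cnt = pending k a [] u ∧ ∃ Q, Queue R k a j m tl Q ∧
      ∀ r ∈ done, m 4 r.addr = pending k a [] r.rhs ∧ (pending k a [] r.rhs = 0 → k + r.lhs ∈ Q))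
    (by simp [countBody, Program.regs]) (by simp [fire, Program.regs])
    (by simp [countBody, Program.banks]) (by simp [fire, Program.banks]) (by simp)
    hR hW h1 h2 h4 h0 ?_ ?_ ?_ ?_
  · exact fun done r rest hd m tl h => ⟨rfl, h⟩
  · rintro done r rest hd u c v hu t s' ha h6 h8 h10 ⟨hcnt, hI⟩
    have e1 := (ha.1 1 (by simp)).trans h1
    have e3 := (ha.1 3 (by simp)).trans h3
    have e12 := (ha.1 12 (by simp)).trans h12
    have hr := hR.addr_lt (r := r) (by simp [hd])
    have hlen : r.rhs.length = u.length + (v.length + 1) := by simp [hu]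
    have hle : pending k a [] u ≤ u.length := List.countP_le_length
    have hadd : pending k a [] (u ++ [c]) =
        pending k a [] u + if c = a ∨ k ≤ c then 1 else 0 := by
      simp [pending, List.countP_append, List.countP_singleton]
    simp only [countBody, wp_ite_lt, wp_ite_eq, wp_add, wp_skip, Store.reg_setReg,
      Store.mem_setReg, reduceIte, Nat.reduceEqDiff, e1, e3, e12, h10, hcnt, hadd]
    refine ⟨fun hlt => ⟨fun he => ⟨by omega, by omega, ?_, hI⟩, fun he => ⟨by omega, ?_, hI⟩⟩,
      fun hge => ⟨by omega, by omega, ?_, hI⟩⟩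
    · simp [he]
    · simp [he]; omega
    · simp [hge]
  · rintro done r rest hd t s' ha h6 ⟨hcnt, Q, hQ, hI⟩
    have hr : r ∈ R := by simp [hd]
    rw [wp_seq, wp_store]
    have hQ' : Queue R k a j (s'.setMem 4 (s'.reg 6) (s'.reg 13)).mem (s'.reg 15) Q :=
      ⟨hQ.nodup, hQ.length, by simpa using hQ.get, by simpa using hQ.mark,
        by simpa using hQ.stale, hQ.productive⟩
    refine ((wp_fire (s := s'.setMem 4 (s'.reg 6) (s'.reg 13)) hR hr hW (hlhs r hr)
      ((ha.1 1 (by simp)).trans h1)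
      ((ha.1 2 (by simp)).trans h2) ((ha.1 3 (by simp)).trans h3) ((ha.1 11 (by simp)).trans h11)
      (by simpa using (ha.2 0 (by simp)).trans h0) h6 hQ' ?_).frame_of_subset
      (l := [7, 14, 15]) (b := [5, 6]) (by simp [fire, Program.regs])
      (by simp [fire, Program.banks])).mono ?_
    · intro hz
      have h := pending_eq_zero.1 (hcnt.symm.trans hz)
      exact .intro r hr (fun c hc => (h c hc).1) fun c hc hk => absurd ((h c hc).2 hk) (by simp)
    · rintro t₁ s₁ ⟨⟨ht, Q', hpre, hQ₁, hz⟩, hag⟩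
      refine ⟨by omega, Q', hQ₁, fun r' hr' => ?_⟩
      have h4 := hag.2 4 (by simp)
      simp only [Store.mem_setMem, reduceIte, h6] at h4
      rw [h4]
      rcases List.mem_append.1 hr' with hr' | hr'
      · have hne : r'.addr ≠ r.addr := (hd ▸ hR : Placed x (done ++ r :: rest)).addr_ne hr'
        rw [Function.update_of_ne hne]
        exact ⟨(hI r' hr').1, fun h => hpre.subset ((hI r' hr').2 h)⟩
      · obtain rfl : r' = r := by simpa using hr'
        simp only [Function.update_self]
        exact ⟨hcnt, fun h => hz (hcnt.trans h)⟩
  · exact ⟨[], hQ, by simp⟩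

/-! ### Propagation through the queue. -/

/-- Treat one occurrence of a symbol: the rule has one pending symbol less. -/
def visit : Program :=
  .seq (.load 6 3 8) <| .seq (.load 13 4 6) <| .seq (.sub 13 13 1) <| .seq (.store 4 6 13) <|
    .seq fire (.load 8 2 8)

/-- Treat the nonterminals in the queue. -/
def drain : Program :=
  .loop (.lt 16 15) <| .seq (.load 10 6 16) <| .seq (.add 16 16 1) <| .seq (.load 8 1 10) <|
    .loop (.lt 2 8) visit

/-- Each position of `l` is counted for at most one member of `P`, as `P` has no repetitions. -/
theorem sum_map_count_le {P : List ℕ} (hP : P.Nodup) (l : List ℕ) :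
    (P.map fun c => l.count c).sum ≤ l.length := by
  induction l with
  | nil => simp
  | cons d l ih =>
    have h : (P.map fun c => if d == c then 1 else 0).sum ≤ 1 := by
      refine le_of_eq_of_le ?_ (List.nodup_iff_count_le_one.1 hP d)
      clear hP ih
      induction P with
      | nil => rfl
      | cons c P ih => rw [List.map_cons, List.sum_cons, List.count_cons, ih, add_comm, BEq.comm]
    simp only [List.count_cons, List.sum_map_add, List.length_cons]
    omega

/-- The number of steps, up to a constant factor, that it takes to treat the nonterminals in `P`. -/
def work (R : List Entry) (P : List ℕ) : ℕ := (P.map fun c => 1 + (occurrences R c).length).sum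

theorem work_concat (R : List Entry) (P : List ℕ) (c : ℕ) :
    work R (P ++ [c]) = work R P + (1 + (occurrences R c).length) := by
  simp [work]

/-- The amortised bound: one unit for each queue entry, at most one entry per rule, and one for each
symbol occurrence, visited at most once. -/
theorem work_le {R : List Entry} {P : List ℕ} (hP : P.Nodup) (hl : P.length ≤ R.length) :
    work R P ≤ 2 * extent R := by
  have h₁ := length_le_extent R
  have h₂ := length_flatMap_rhs_le_extent R
  have h₃ := sum_map_count_le hP (R.flatMap Entry.rhs)
  simp only [work, length_occurrences, List.sum_map_add, List.map_const', List.sum_replicate,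
    smul_eq_mul, mul_one]
  omega

theorem wp_drain {W : ℕ} {R : List Entry} {x : ℕ → ℕ} {k a j : ℕ} {s : Store} {t : ℕ} {Q : List ℕ}
    (hR : Placed x R) (ha : a < k) (hW : 4 + extent R ≤ W)
    (hlhs : ∀ r ∈ R, k + r.lhs ≤ W)
    (h1 : s.reg 1 = 1) (h2 : s.reg 2 = 0) (h3 : s.reg 3 = k)
    (h11 : s.reg 11 = j) (h16 : s.reg 16 = 0) (h0 : s.mem 0 = x) (hL : Linked R s.mem)
    (hQ : Queue R k a j s.mem (s.reg 15) Q)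
    (hc : ∀ r ∈ R, s.mem 4 r.addr = pending k a [] r.rhs ∧
      (pending k a [] r.rhs = 0 → k + r.lhs ∈ Q)) :
    WP W drain (fun t' s' => t' ≤ t + 100 * extent R + 10 ∧
      (∀ c, s'.mem 5 c = 0 ∨ j ≤ s'.mem 5 c) ∧
      ∀ c, s'.mem 5 c = j ↔ Productive R k a c) t s := by
  let F : List ℕ := [6, 7, 8, 10, 13, 14, 15, 16]
  let B : List ℕ := [4, 5, 6]
  have hvb : visit.banks ⊆ B := by simp [visit, fire, Program.banks, B]
  have hl' := length_le_extent R
  -- `P` is the treated part of the queue and `P'` the waiting part. The loop ends because the queue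
  -- never outgrows the number of rules.
  refine wp_loop_lt (n := R.length) (fun n t' s' => ∃ P P', P.length + n = R.length ∧
    Queue R k a j s'.mem (s'.reg 15) (P ++ P') ∧ s'.reg 16 = P.length ∧ Agree F B s s' ∧
    t' ≤ t + 40 * work R P ∧
    ∀ r ∈ R, s'.mem 4 r.addr = pending k a P r.rhs ∧
      (pending k a P r.rhs = 0 → k + r.lhs ∈ P ++ P')) ?_ ?_ ?_
  · exact ⟨[], Q, by simp, hQ, h16, .refl _ _ _, by simp [work], hc⟩
  · rintro n t₁ s₁ ⟨P, P', hn, hQ₁, g16, hag, ht, hI⟩ hlt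
    have hlen := hQ₁.length_le
    obtain _ | ⟨c, P'⟩ := P'
    · have := hQ₁.length; simp at this; omega
    have hck : k ≤ c := (hQ₁.productive c (by simp)).le
    have hcP : c ∉ P := fun h => (List.nodup_append.1 hQ₁.nodup).2.2 c h c (by simp) rfl
    have hget : s₁.mem 6 P.length = c := by rw [hQ₁.get _ (by simp)]; simp
    have e1 : s₁.reg 1 = 1 := (hag.1 1 (by simp [F])).trans h1
    have e2 : s₁.reg 2 = 0 := (hag.1 2 (by simp [F])).trans h2
    simp only [List.length_append, List.length_cons] at hlen
    simp only [wp_seq, wp_load, wp_add, Store.reg_setReg, Store.mem_setReg, reduceIte,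
      Nat.reduceEqDiff, g16, e1, hget]
    refine ⟨by omega, ?_⟩
    -- While `c` is being treated, a counter exceeds its final value, the one for `P ++ [c]`, by the
    -- number of occurrences of `c` in that rule still to be visited, which are those in `l'`.
    refine wp_loop_lt (n := (occurrences R c).length) (fun n' t' s' => ∃ l l' b Q',
      occurrences R c = l ++ l' ∧ l'.length = n' ∧ Chain (s'.mem 2) (s'.mem 3) b (s'.reg 8) l' ∧
      Queue R k a j s'.mem (s'.reg 15) (P ++ c :: Q') ∧ s'.reg 16 = P.length + 1 ∧ Agree F B s s' ∧
      t' ≤ t + 40 * work R P + 20 + 30 * l.length ∧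
      ∀ r ∈ R, s'.mem 4 r.addr = pending k a (P ++ [c]) r.rhs + l'.count r.addr ∧
        (s'.mem 4 r.addr = 0 → k + r.lhs ∈ P ++ c :: Q')) ?_ ?_ ?_
    · refine ⟨[], occurrences R c, 4 + extent R, P', rfl, rfl, ?_, by simpa using hQ₁, by simp, ?_,
        by simp; omega, fun r hr => ?_⟩
      · have h := hL c
        rw [← hag.2 1 (by simp [B]), ← hag.2 2 (by simp [B]), ← hag.2 3 (by simp [B])] at h
        simpa using h
      · refine hag.trans (l₂ := [8, 10, 16]) (b₂ := []) ?_ (by simp) (by simp) (by simp [F])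
          (by simp)
        exact ⟨fun i hi => by simp at hi; simp [hi], fun _ _ => rfl⟩
      · rw [count_occurrences hR hr]
        have := pending_concat r.rhs ha hck hcP
        exact ⟨by rw [← this]; exact (hI r hr).1, fun h => (hI r hr).2 ((hI r hr).1.symm.trans h)⟩
    · rintro n' t₂ s₂ ⟨l, l', b, Q', hl, hn', hch, hQ₂, f16, fag, ft, fI⟩ flt
      have f1 : s₂.reg 1 = 1 := (fag.1 1 (by simp [F])).trans h1
      have f2 : s₂.reg 2 = 0 := (fag.1 2 (by simp [F])).trans h2
      obtain _ | ⟨q, l'⟩ := l'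
      · have : s₂.reg 8 = 0 := hch
        omega
      obtain ⟨-, -, hq, hch⟩ := hch
      obtain ⟨r, hr, rfl⟩ := exists_of_mem_occurrences (R := R) (c := c) (q := q) (by simp [hl])
      have hcnt := (fI r hr).1
      rw [List.count_cons_self] at hcnt
      have hvis : WP W visit (fun t' s' => t' ≤ t₂ + 30 ∧ s'.reg 8 = s₂.mem 2 (s₂.reg 8) ∧
          s'.mem 4 = Function.update (s₂.mem 4) r.addr (s₂.mem 4 r.addr - 1) ∧
          ∃ Q'', P ++ c :: Q' <+: Q'' ∧ Queue R k a j s'.mem (s'.reg 15) Q'' ∧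
          (s₂.mem 4 r.addr - 1 = 0 → k + r.lhs ∈ Q'')) (t₂ + 1) s₂ := by
        simp only [visit, wp_seq, wp_load, wp_sub, wp_store, Store.reg_setReg, Store.mem_setReg,
          reduceIte, Nat.reduceEqDiff, hq, f1]
        refine ((wp_fire (a := a) (j := j) (r := r) (Q := P ++ c :: Q') hR hr hW
          (hlhs r hr) ?_ ?_ ?_ ?_ ?_ ?_ ?_
          ?_).frame_of_subset (l := [7, 14, 15]) (b := [5, 6]) (by simp [fire, Program.regs])
          (by simp [fire, Program.banks])).mono ?_
        · simpa using f1
        · simpa using f2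
        · simpa using (fag.1 3 (by simp [F])).trans h3
        · simpa using (fag.1 11 (by simp [F])).trans h11
        · simpa using (fag.2 0 (by simp [B])).trans h0
        · simp
        · exact ⟨hQ₂.nodup, by simpa using hQ₂.length, by simpa using hQ₂.get,
            by simpa using hQ₂.mark, by simpa using hQ₂.stale, hQ₂.productive⟩
        · intro hz
          simp only [Store.reg_setReg, Store.reg_setMem, reduceIte] at hz
          -- The visited occurrence itself accounts for one unit of the counter, so a counter that
          -- drops to zero leaves nothing pending.
          have hp := pending_eq_zero.1 (by omega : pending k a (P ++ [c]) r.rhs = 0)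
          refine .intro r hr (fun d hd => (hp d hd).1) fun d hd hk => hQ₂.productive d ?_
          have := (hp d hd).2 hk
          simp at this ⊢
          tauto
        · rintro t₃ s₃ ⟨⟨kt, Q'', kp, kQ, kz⟩, kag⟩
          have k8 := kag.1 8 (by simp)
          have k4 := kag.2 4 (by simp)
          have k2 := kag.2 2 (by simp)
          simp only [Store.reg_setReg, Store.reg_setMem, Store.mem_setMem, Store.mem_setReg,
            reduceIte, Nat.reduceEqDiff] at k8 k4 k2
          refine ⟨by omega, by simp [k8, k2], by simp [k4], Q'', kp, by simpa using kQ, ?_⟩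
          simpa using kz
      refine (hvis.frame_of_subset (l := [6, 7, 8, 13, 14, 15]) (b := B)
        (by simp [visit, fire, Program.regs]) hvb).mono ?_
      rintro t₃ s₃ ⟨⟨kt, k8, k4, Q'', ⟨Q₃, rfl⟩, kQ, kz⟩, kag⟩
      have k2 := kag.2 2 (by simp [B])
      have k3 := kag.2 3 (by simp [B])
      refine ⟨l'.length, by simp at hn'; omega, l ++ [r.addr], l', s₂.reg 8, Q' ++ Q₃, by simp [hl],
        rfl, ?_, by simpa using kQ, ?_, ?_, by simp; omega, fun r' hr' => ?_⟩
      · rw [k2, k3, k8]; exact hch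
      · rw [kag.1 16 (by simp), f16]
      · exact fag.trans kag (by simp) (by simp) (by simp [F]) (by simp)
      · rw [k4]
        have h := fI r' hr'
        by_cases he : r'.addr = r.addr
        -- Both left sides are read from the same memory cell, so identity of the rules is not
        -- needed.
        · have hlr : r'.lhs = r.lhs := by rw [← hR.eq_lhs hr', ← hR.eq_lhs hr, he]
          rw [he, List.count_cons_self] at h
          rw [he, hlr, Function.update_self]
          exact ⟨by omega, fun hz => by simpa using kz hz⟩
        · rw [Function.update_of_ne he]
          rw [List.count_cons_of_ne (Ne.symm he)] at h
          refine ⟨h.1, fun hz => ?_⟩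
          have := h.2 hz
          simp at this ⊢
          tauto
    · rintro n' t₂ s₂ ⟨l, l', b, Q', hl, hn', hch, hQ₂, f16, fag, ft, fI⟩ fle
      have f2 : s₂.reg 2 = 0 := (fag.1 2 (by simp [F])).trans h2
      obtain rfl : l' = [] := by
        obtain _ | ⟨q, l'⟩ := l'
        · rfl
        · have := hch.1; omega
      refine ⟨n - 1, by omega, P ++ [c], Q', by simp; omega, by simpa using hQ₂, by simpa using f16,
        fag, ?_, fun r hr => ?_⟩
      · rw [work_concat, hl]; simp; omega
      · have h := fI r hr
        simp only [List.count_nil, add_zero] at h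
        exact ⟨h.1, fun hz => by simpa using h.2 (h.1.trans hz)⟩
  · rintro n t₁ s₁ ⟨P, P', hn, hQ₁, g16, hag, ht, hI⟩ hle
    have hlen := hQ₁.length
    obtain rfl : P' = [] := List.length_eq_zero_iff.1 (by simp at hlen; omega)
    rw [List.append_nil] at hQ₁
    have := work_le hQ₁.nodup hQ₁.length_le
    refine ⟨by omega, hQ₁.stale,
      fun c => ⟨fun h => hQ₁.productive c ((hQ₁.mark c).1 h), fun h => ?_⟩⟩
    -- Completeness: with nothing left waiting, `P` is closed under the rules that avoid `a`, so it
    -- contains the least such set.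
    refine (hQ₁.mark c).2 ?_
    induction h with
    | intro r hr hra _ ih =>
      simpa using (hI r hr).2 (pending_eq_zero.2 fun c hc => ⟨hra c hc, ih c hc⟩)

/-! ### The whole program -/

/-- Put zero into register `0` if the nonterminal in register `17` yields a word without the letter
that precedes the number in register `11`, and decrease register `11`. -/
def round : Program :=
  .seq (.sub 12 11 1) <| .seq (.const 15 0) <| .seq (.const 16 0) <| .seq countPending <|
    .seq drain <| .seq (.load 14 5 17) <| .seq (.ite (.eq 14 11) (.const 0 0) .skip) (.copy 11 12)

theorem regs_countPending : countPending.regs ⊆ scanRegs := by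
  simp [countPending, scan, countBody, fire, Program.regs]

theorem banks_countPending : countPending.banks ⊆ [4, 5, 6] := by
  simp [countPending, scan, countBody, fire, Program.banks]

theorem regs_drain : drain.regs ⊆ [6, 7, 8, 10, 13, 14, 15, 16] := by
  simp [drain, visit, fire, Program.regs]

theorem banks_drain : drain.banks ⊆ [4, 5, 6] := by
  simp [drain, visit, fire, Program.banks]

theorem regs_round : round.regs ⊆ 0 :: 11 :: 12 :: 16 :: scanRegs := by decide

theorem banks_round : round.banks ⊆ [4, 5, 6] := by decide

/-- Round `j` treats the letter `j - 1`. The shift keeps round numbers positive, hence distinct from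
the initial content of the marks. -/
theorem wp_round {W : ℕ} {R : List Entry} {x : ℕ → ℕ} {k j : ℕ} {s : Store} {t : ℕ}
    (hR : Placed x R) (hj : 0 < j) (hk : j ≤ k) (hW : 4 + extent R ≤ W)
    (hlhs : ∀ r ∈ R, k + r.lhs ≤ W) (h1 : s.reg 1 = 1) (h2 : s.reg 2 = 0) (h3 : s.reg 3 = k)
    (h4 : s.reg 4 = R.length) (h11 : s.reg 11 = j) (h0 : s.mem 0 = x) (hL : Linked R s.mem)
    (hm : ∀ c, s.mem 5 c = 0 ∨ j < s.mem 5 c) :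
    WP W round (fun t' s' => t' ≤ t + 150 * extent R + 40 ∧
      (∀ c, s'.mem 5 c = 0 ∨ j ≤ s'.mem 5 c) ∧ s'.reg 11 = j - 1 ∧
      (Productive R k (j - 1) (s.reg 17) → s'.reg 0 = 0) ∧
      (¬ Productive R k (j - 1) (s.reg 17) → s'.reg 0 = s.reg 0)) t s := by
  simp only [round, wp_seq, wp_sub, wp_const]
  refine ⟨by omega, by omega, ?_⟩
  rw [h11, h1]
  have hag : Agree [12, 15, 16] [] s (((s.setReg 12 (j - 1)).setReg 15 0).setReg 16 0) :=
    ⟨fun i hi => by simp at hi; simp [hi], fun _ _ => rfl⟩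
  have g12 : (((s.setReg 12 (j - 1)).setReg 15 0).setReg 16 0).reg 12 = j - 1 := by simp
  have g15 : (((s.setReg 12 (j - 1)).setReg 15 0).setReg 16 0).reg 15 = 0 := by simp
  have g16 : (((s.setReg 12 (j - 1)).setReg 15 0).setReg 16 0).reg 16 = 0 := by simp
  generalize ((s.setReg 12 (j - 1)).setReg 15 0).setReg 16 0 = s₁ at *
  -- Every mark is zero or larger than `j > 0`, so the empty queue matches the marks without any
  -- clearing.
  have hQ : Queue R k (j - 1) j s₁.mem (s₁.reg 15) [] := by
    refine ⟨by simp, by simp [g15], by simp, fun c => ?_, fun c => ?_, by simp⟩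
    · have := hm c
      rw [← hag.2 5 (by simp)] at this
      simp only [List.not_mem_nil, iff_false]
      omega
    · have := hm c
      rw [← hag.2 5 (by simp)] at this
      omega
  refine ((wp_countPending hR hW hlhs ((hag.1 1 (by simp)).trans h1) ((hag.1 2 (by simp)).trans h2)
    ((hag.1 3 (by simp)).trans h3) ((hag.1 4 (by simp)).trans h4) ((hag.1 11 (by simp)).trans h11)
    g12 ((hag.2 0 (by simp)).trans h0) hQ).frame_of_subset regs_countPending
    banks_countPending).mono ?_
  rintro t₂ s₂ ⟨⟨ht₂, Q, hQ₂, hc⟩, hag₂⟩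
  have hL₂ : Linked R s₂.mem := by
    intro c
    rw [hag₂.2 1 (by simp), hag₂.2 2 (by simp), hag₂.2 3 (by simp), hag.2 1 (by simp),
      hag.2 2 (by simp), hag.2 3 (by simp)]
    exact hL c
  have k16 : s₂.reg 16 = 0 := (hag₂.1 16 (by simp)).trans g16
  have k12 : s₂.reg 12 = j - 1 := (hag₂.1 12 (by simp)).trans g12
  have hag' : Agree [5, 6, 7, 8, 9, 10, 12, 13, 14, 15, 16] [4, 5, 6] s s₂ :=
    hag.trans hag₂ (by simp) (by simp) (by simp) (by simp)
  rw [wp_seq]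
  refine ((wp_drain hR (by omega) hW hlhs ((hag'.1 1 (by simp)).trans h1)
    ((hag'.1 2 (by simp)).trans h2) ((hag'.1 3 (by simp)).trans h3)
    ((hag'.1 11 (by simp)).trans h11) k16 ((hag'.2 0 (by simp)).trans h0) hL₂ hQ₂
    hc).frame_of_subset regs_drain banks_drain).mono ?_
  rintro t₃ s₃ ⟨⟨ht₃, hst, hmark⟩, hag₃⟩
  have l12 : s₃.reg 12 = j - 1 := (hag₃.1 12 (by simp)).trans k12
  have l11 : s₃.reg 11 = j := ((hag₃.1 11 (by simp)).trans (hag'.1 11 (by simp))).trans h11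
  have l17 : s₃.reg 17 = s.reg 17 := (hag₃.1 17 (by simp)).trans (hag'.1 17 (by simp))
  have l0 : s₃.reg 0 = s.reg 0 := (hag₃.1 0 (by simp)).trans (hag'.1 0 (by simp))
  simp only [wp_seq, wp_load, wp_ite_eq, wp_const, wp_skip, wp_copy, Store.reg_setReg,
    Store.mem_setReg, reduceIte, Nat.reduceEqDiff, l12, l11, l17, l0, hmark]
  refine ⟨fun hp => ⟨by omega, by omega, hst, by simp, ?_⟩,
    fun hp => ⟨by omega, hst, by simp, ?_⟩⟩
  · simp [hp]
  · have hp' : ¬ Productive R k (j - 1) (s.reg 17) := fun h => hp ((hmark _).2 h)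
    simp [hp']

/-- Decide for a grammar whether all its words contain all letters. -/
def decidePangrams : Program :=
  .seq (.const 0 1) <| .seq (.const 1 1) <| .seq (.const 6 3) <| .seq (.load 4 0 6) <|
    .seq (.const 6 2) <| .seq (.load 17 0 6) <| .seq (.load 3 0 2) <| .seq (.add 17 17 3) <|
    .ite (.lt 2 3) (.ite (.lt 2 4) (.seq link <| .seq (.copy 11 3) <| .loop (.lt 2 11) round)
      .skip) .skip

/-- The two tests serve the time bound. Without letters, building the lists would cost `extent R`,
and without rules the rounds would cost `k`, while `k * extent R` is zero. In both cases the answer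
is yes. -/
theorem wp_decidePangrams {W : ℕ} {R : List Entry} {x : ℕ → ℕ} {k i : ℕ} {s : Store}
    (hR : Placed x R) (hW : 4 + extent R ≤ W) (hi : k + i ≤ W) (hlhs : ∀ r ∈ R, k + r.lhs ≤ W)
    (h2 : s.reg 2 = 0) (h0 : s.mem 0 = x) (hs : ∀ b ≠ 0, ∀ a, s.mem b a = 0)
    (hxk : x 0 = k) (hxi : x 2 = i) (hxn : x 3 = R.length) :
    WP W decidePangrams (fun t s' => t ≤ 400 * (k * extent R + 1) ∧
      (s'.reg 0 = 1 ↔ ∀ a < k, ¬ Productive R k a (k + i))) 0 s := by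
  simp only [decidePangrams, wp_seq, wp_const, wp_load, wp_add, Store.reg_setReg,
    Store.mem_setReg, reduceIte, Nat.reduceEqDiff, OfNat.ofNat_ne_zero, OfNat.ofNat_ne_one,
    h2, h0, hxk, hxi, hxn, add_comm i]
  refine ⟨by omega, by omega, by omega, by omega, hi, ?_⟩
  set s₁ : Store := ((((((((s.setReg 0 1).setReg 1 1).setReg 6 3).setReg 4 R.length).setReg 6
    2).setReg 17 i).setReg 3 k).setReg 17 (k + i)) with hs₁
  have g0 : s₁.reg 0 = 1 := by simp [hs₁]
  have g1 : s₁.reg 1 = 1 := by simp [hs₁]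
  have g2 : s₁.reg 2 = 0 := by simp [hs₁, h2]
  have g3 : s₁.reg 3 = k := by simp [hs₁]
  have g4 : s₁.reg 4 = R.length := by simp [hs₁]
  have g17 : s₁.reg 17 = k + i := by simp [hs₁]
  have gm : s₁.mem = s.mem := rfl
  clear_value s₁
  simp only [wp_ite_lt, wp_skip, g2, g3, g4]
  refine ⟨fun hk => ⟨fun hn => ?_, fun hn => ⟨by omega, iff_of_true g0 fun a ha hp => ?_⟩⟩,
    fun hk => ⟨by omega, iff_of_true g0 fun a ha => by omega⟩⟩
  · rw [wp_seq]
    refine ((wp_link hR hW g1 g2 g4 (gm ▸ h0) (fun c => gm ▸ hs 1 (by simp) c)).frame_of_subset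
      (l := scanRegs) (b := [1, 2, 3]) (by simp [link, scan, linkBody, Program.regs])
      (by simp [link, scan, linkBody, Program.banks])).mono ?_
    rintro t₂ s₂ ⟨⟨ht₂, hL₂⟩, hag₂⟩
    rw [wp_seq, wp_copy, hag₂.1 3 (by simp), g3]
    have hlast : ∀ (t : ℕ) (s' : Store), t ≤ 200 + 50 * extent R + (150 * extent R + 50) * k ∧
        (s'.reg 0 = 1 ↔ ∀ a < k, 0 ≤ a → ¬ Productive R k a (k + i)) →
        t ≤ 400 * (k * extent R + 1) ∧
        (s'.reg 0 = 1 ↔ ∀ a < k, ¬ Productive R k a (k + i)) := by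
      rintro t s' ⟨ht, hs'⟩
      refine ⟨ht.trans ?_, by simpa using hs'⟩
      -- With both factors positive, each of them is at most the product, which absorbs the linear
      -- terms.
      have hE := length_le_extent R
      have h₁ : extent R ≤ k * extent R := Nat.le_mul_of_pos_left _ hk
      have h₂ : k ≤ k * extent R := Nat.le_mul_of_pos_right _ (by omega)
      have h₃ : (150 * extent R + 50) * k = 150 * (k * extent R) + 50 * k := by ring
      omega
    refine WP.mono ?_ hlast
    -- The time spent plus the budget of the `n` remaining rounds stays bounded. The letters from
    -- `n` on have been treated.
    refine wp_loop_lt (n := k) (fun n t' s' => n ≤ k ∧ s'.reg 11 = n ∧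
      Agree (0 :: 11 :: 12 :: 16 :: scanRegs) [4, 5, 6] s₂ s' ∧
      t' + (150 * extent R + 50) * n ≤ 100 + 50 * extent R + (150 * extent R + 50) * k ∧
      (∀ c, s'.mem 5 c = 0 ∨ n < s'.mem 5 c) ∧
      (s'.reg 0 = 1 ↔ ∀ a < k, n ≤ a → ¬ Productive R k a (k + i))) ?_ ?_ ?_
    · refine ⟨le_rfl, by simp, ?_, by omega, fun c => .inl ?_, ?_⟩
      · exact (Agree.refl [] [] s₂).trans (Agree.setReg _ _ _) (by simp) (by simp) (by simp)
          (by simp)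
      · rw [Store.mem_setReg, hag₂.2 5 (by simp), gm]
        exact hs 5 (by simp) c
      · refine iff_of_true ?_ fun a ha ha' => by omega
        simp [hag₂.1 0, g0]
    · rintro n t₃ s₃ ⟨hnk, k11, kag, kt, km, k0⟩ hlt
      have e (r : ℕ) (hr : r ∉ 0 :: 11 :: 12 :: 16 :: scanRegs) : s₃.reg r = s₁.reg r :=
        (kag.1 r hr).trans (hag₂.1 r fun h => hr (by simp [h]))
      have hn : 0 < n := by rw [e 2 (by simp), g2] at hlt; omega
      have hL₃ : Linked R s₃.mem := by
        intro c
        rw [kag.2 1 (by simp), kag.2 2 (by simp), kag.2 3 (by simp)]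
        exact hL₂ c
      have hx₃ : s₃.mem 0 = x := by rw [kag.2 0 (by simp), hag₂.2 0 (by simp), gm, h0]
      refine ((wp_round hR hn hnk hW hlhs (by rw [e 1 (by simp), g1]) (by rw [e 2 (by simp), g2])
        (by rw [e 3 (by simp), g3]) (by rw [e 4 (by simp), g4]) k11 hx₃ hL₃ km).frame_of_subset
        regs_round banks_round).mono ?_
      rintro t₄ s₄ ⟨⟨lt, lm, l11, lp, lq⟩, lag⟩
      rw [e 17 (by simp), g17] at lp lq
      refine ⟨n - 1, by omega, by omega, l11, kag.trans lag (by simp) (by simp) (by simp) (by simp),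
        ?_, fun c => (lm c).imp_right (by omega), ?_⟩
      · have : (150 * extent R + 50) * n =
            (150 * extent R + 50) * (n - 1) + (150 * extent R + 50) := by
          conv_lhs => rw [← Nat.sub_add_cancel hn, Nat.mul_add_one]
        omega
      · by_cases hp : Productive R k (n - 1) (k + i)
        · rw [lp hp]
          exact iff_of_false (by simp) fun h => h (n - 1) (by omega) le_rfl hp
        · rw [lq hp, k0]
          refine ⟨fun h a ha hna => ?_, fun h a ha hna => h a ha (by omega)⟩
          obtain rfl | hne := eq_or_ne a (n - 1)
          · exact hp
          · exact h a ha (by omega)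
    · rintro n t₃ s₃ ⟨hnk, k11, kag, kt, km, k0⟩ hle
      have hz : s₃.reg 2 = 0 := by rw [kag.1 2 (by simp), hag₂.1 2 (by simp), g2]
      obtain rfl : n = 0 := by omega
      exact ⟨by omega, k0⟩
  · obtain rfl : R = [] := List.length_eq_zero_iff.1 (by omega)
    generalize k + i = c at hp
    cases hp with
    | intro r hr => simp at hr

end RAM

/-! ### Grammars in memory -/

section

variable {T N : Type*} {k m : ℕ} (eT : T ≃ Fin k) (eN : N ≃ Fin m)

/-- The rules with their addresses, if their codes begin at the address `q`. -/
def layout : ℕ → List (ContextFreeRule T N) → List RAM.Entry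
  | _, [] => []
  | q, r :: rs => ⟨q, eN r.input, r.output.map (encodeSymbol eT eN)⟩ ::
      layout (q + (2 + r.output.length)) rs

theorem length_layout (q : ℕ) (rs : List (ContextFreeRule T N)) :
    (layout eT eN q rs).length = rs.length := by
  induction rs generalizing q with
  | nil => rfl
  | cons r rs ih => simp [layout, ih]

theorem extent_layout (q : ℕ) (rs : List (ContextFreeRule T N)) :
    RAM.extent (layout eT eN q rs) = (rs.map fun r => 2 + r.output.length).sum := by
  induction rs generalizing q with
  | nil => rfl
  | cons r rs ih => simp [layout, ih]

theorem exists_rule_of_mem_layout {q : ℕ} {rs : List (ContextFreeRule T N)} {e : RAM.Entry}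
    (he : e ∈ layout eT eN q rs) :
    ∃ r ∈ rs, e.lhs = eN r.input ∧ e.rhs = r.output.map (encodeSymbol eT eN) := by
  induction rs generalizing q with
  | nil => simp [layout] at he
  | cons r rs ih =>
    rcases List.mem_cons.1 he with rfl | he
    · exact ⟨r, by simp, rfl, rfl⟩
    · obtain ⟨r', hr', h⟩ := ih he
      exact ⟨r', by simp [hr'], h⟩

theorem exists_mem_layout (q : ℕ) {rs : List (ContextFreeRule T N)} {r : ContextFreeRule T N}
    (hr : r ∈ rs) :
    ∃ e ∈ layout eT eN q rs, e.lhs = eN r.input ∧ e.rhs = r.output.map (encodeSymbol eT eN) := by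
  induction rs generalizing q with
  | nil => simp at hr
  | cons r' rs ih =>
    rcases List.mem_cons.1 hr with rfl | hr
    · exact ⟨_, List.mem_cons_self, rfl, rfl⟩
    · obtain ⟨e, he, h⟩ := ih (q + (2 + r'.output.length)) hr
      exact ⟨e, List.mem_cons_of_mem _ he, h⟩

/-- The prefix `pre` is arbitrary so that the induction can move the code of the first rule into it.
-/
theorem layout_spec (pre : List ℕ) (rs : List (ContextFreeRule T N)) {done rest : List RAM.Entry}
    {e : RAM.Entry} (h : layout eT eN pre.length rs = done ++ e :: rest) :
    e.addr = pre.length + RAM.extent done ∧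
    (pre ++ rs.flatMap (encodeRule eT eN)).getD e.addr 0 = e.lhs ∧
    (pre ++ rs.flatMap (encodeRule eT eN)).getD (e.addr + 1) 0 = e.rhs.length ∧
    ∀ u c v, e.rhs = u ++ c :: v →
      (pre ++ rs.flatMap (encodeRule eT eN)).getD (e.addr + 2 + u.length) 0 = c := by
  induction rs generalizing pre done with
  | nil => simp [layout] at h
  | cons r rs ih =>
    obtain _ | ⟨d, done⟩ := done
    · obtain ⟨rfl, -⟩ := List.cons.inj h
      refine ⟨rfl, by simp [encodeRule], by simp [encodeRule], ?_⟩
      intro u c v hu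
      simp only at hu
      rw [add_assoc, List.getD_append_right _ _ _ _ (Nat.le_add_right _ _)]
      simp [encodeRule, hu, Nat.add_comm 2]
    · obtain ⟨rfl, h'⟩ := List.cons.inj h
      have hl : (pre ++ encodeRule eT eN r).length = pre.length + (2 + r.output.length) := by
        simp [encodeRule]; omega
      rw [← hl] at h'
      obtain ⟨h₁, h₂⟩ := ih _ h'
      refine ⟨?_, by simpa using h₂⟩
      rw [h₁, hl]
      simp [add_assoc]

theorem placed_layout (initial : N) (rs : List (ContextFreeRule T N)) :
    RAM.Placed (fun a => (encodeGrammar eT eN initial rs).getD a 0) (layout eT eN 4 rs) :=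
  fun _ _ _ h => layout_spec eT eN [k, m, (eN initial : ℕ), rs.length] rs h

end

/-! ### Productive nonterminals and derivations -/

namespace ContextFreeGrammar

variable {T : Type*} {g : ContextFreeGrammar T} {k m : ℕ} {eT : T ≃ Fin k} {eN : g.NT ≃ Fin m}
  {rules : List (ContextFreeRule T g.NT)} {q : ℕ} {a : T}

theorem exists_derives_of_forall_mem {l : List (Symbol T g.NT)}
    (h : ∀ s ∈ l, ∃ w : List T, g.Derives [s] (w.map Symbol.terminal) ∧ a ∉ w) :
    ∃ w : List T, g.Derives l (w.map Symbol.terminal) ∧ a ∉ w := by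
  induction l with
  | nil => exact ⟨[], .refl _, by simp⟩
  | cons s l ih =>
    obtain ⟨w₁, h₁, ha₁⟩ := h s (by simp)
    obtain ⟨w₂, h₂, ha₂⟩ := ih fun s hs => h s (by simp [hs])
    refine ⟨w₁ ++ w₂, ?_, by simp [ha₁, ha₂]⟩
    rw [List.map_append]
    exact (h₁.append_right l).trans (h₂.append_left _)

/-- Apply the rule, then concatenate words without `a` derived from the symbols of its right side; a
letter there differs from `a` and derives itself. -/
theorem exists_derives_of_productive (hrules : ∀ r, r ∈ rules ↔ r ∈ g.rules) {A : g.NT}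
    (h : RAM.Productive (layout eT eN q rules) k (eT a) (k + eN A)) :
    ∃ w : List T, g.Derives [.nonterminal A] (w.map Symbol.terminal) ∧ a ∉ w := by
  generalize hc : k + (eN A : ℕ) = c at h
  induction h generalizing A with
  | intro e he hea _ ih =>
    obtain ⟨r, hr, hl, hrhs⟩ := exists_rule_of_mem_layout eT eN he
    obtain rfl : A = r.input := eN.injective (Fin.ext (by omega))
    obtain ⟨w, hw, haw⟩ := exists_derives_of_forall_mem (g := g) (l := r.output) (a := a) <| by
      intro s hs
      have hmem : encodeSymbol eT eN s ∈ e.rhs := hrhs ▸ List.mem_map_of_mem hs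
      cases s with
      | terminal b =>
        refine ⟨[b], .refl _, fun hab => hea _ hmem ?_⟩
        rw [List.mem_singleton.1 hab]; rfl
      | nonterminal B => exact ih _ hmem (Nat.le_add_right _ _) rfl
    refine ⟨w, .trans (Produces.single ?_) hw, haw⟩
    exact ⟨r, (hrules r).1 hr, .input_output⟩

/-- The property "no `a`, and all nonterminals productive" holds for the final word and is carried
backwards along the derivation: the right side of the rule applied has it, so the rewritten
nonterminal is productive. No derivation trees are needed. -/
theorem productive_of_derives (hrules : ∀ r, r ∈ rules ↔ r ∈ g.rules) {l : List (Symbol T g.NT)}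
    {w : List T} (h : g.Derives l (w.map Symbol.terminal)) (ha : a ∉ w) :
    (∀ b, Symbol.terminal b ∈ l → b ≠ a) ∧ ∀ A, Symbol.nonterminal A ∈ l →
      RAM.Productive (layout eT eN q rules) k (eT a) (k + eN A) := by
  induction h using Relation.ReflTransGen.head_induction_on with
  | refl =>
    refine ⟨fun b hb hba => ha ?_, fun A hA => ?_⟩
    · simpa [hba] using hb
    · simp at hA
  | head h _ ih =>
    obtain ⟨r, hr, hrw⟩ := h
    obtain ⟨u, v, rfl, rfl⟩ := hrw.exists_parts
    refine ⟨fun b hb => ih.1 b ?_, fun A hA => ?_⟩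
    · simp at hb ⊢; tauto
    · by_cases hA' : A = r.input
      · subst hA'
        obtain ⟨e, he, hl, hrhs⟩ := exists_mem_layout eT eN q ((hrules r).2 hr)
        rw [← hl]
        refine .intro e he (fun c hc hca => ?_) fun c hc hk => ?_
        · rw [hrhs] at hc
          obtain ⟨s, hs, rfl⟩ := List.mem_map.1 hc
          cases s with
          | terminal b =>
            exact ih.1 b (by simp [hs]) (eT.injective (Fin.ext hca))
          | nonterminal B =>
            have := (eT a).isLt
            simp only [encodeSymbol] at hca
            omega
        · rw [hrhs] at hc
          obtain ⟨s, hs, rfl⟩ := List.mem_map.1 hc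
          cases s with
          | terminal b =>
            have := (eT b).isLt
            simp only [encodeSymbol] at hk
            omega
          | nonterminal B => exact ih.2 B (by simp [hs])
      · refine ih.2 A ?_
        simp [hA'] at hA ⊢; tauto

theorem language_le_pangrams_iff (hrules : ∀ r, r ∈ rules ↔ r ∈ g.rules) :
    g.language ≤ pangrams T ↔
      ∀ i < k, ¬ RAM.Productive (layout eT eN q rules) k i (k + eN g.initial) := by
  constructor
  · intro h i hi hp
    obtain ⟨a, ha⟩ := eT.surjective ⟨i, hi⟩
    have hp' : RAM.Productive (layout eT eN q rules) k (eT a) (k + eN g.initial) := by rwa [ha]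
    obtain ⟨w, hw, haw⟩ := exists_derives_of_productive hrules hp'
    exact haw (h hw a)
  · intro h w hw a
    by_contra haw
    exact h (eT a) (eT a).isLt ((productive_of_derives hrules hw haw).2 _ (by simp))

theorem size_eq_sum (hnd : rules.Nodup) (hrules : ∀ r, r ∈ rules ↔ r ∈ g.rules) :
    g.size = (rules.map fun r => 1 + r.output.length).sum := by
  classical
  rw [size, ← List.sum_toFinset _ hnd]
  exact Finset.sum_congr (by ext r; simp [hrules]) fun _ _ => rfl

theorem extent_layout_le (hnd : rules.Nodup) (hrules : ∀ r, r ∈ rules ↔ r ∈ g.rules) :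
    RAM.extent (layout eT eN q rules) ≤ 2 * g.size := by
  rw [extent_layout, size_eq_sum hnd hrules, ← List.sum_map_mul_left]
  exact List.sum_le_sum fun r _ => by omega

end ContextFreeGrammar

/-- There is one program of the word random access machine that decides, given any alphabet `T` and
any context-free grammar `g` over `T`, whether all words of `g` are pangrams, in `O(|T| * |g|)`
steps, with words bounded linearly in the number of letters, nonterminals and symbol occurrences. -/
theorem mainTheorem12 :
    ∃ (p : RAM.Program) (c : ℕ),
      ∀ (T : Type*) [Fintype T] (g : ContextFreeGrammar T) [Fintype g.NT]
        (eT : T ≃ Fin (Fintype.card T)) (eN : g.NT ≃ Fin (Fintype.card g.NT))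
        (rules : List (ContextFreeRule T g.NT)), rules.Nodup → (∀ r, r ∈ rules ↔ r ∈ g.rules) →
        ∀ W : ℕ, c * (Fintype.card T + Fintype.card g.NT + g.size + 1) ≤ W →
          ∃ s : RAM.Store,
            RAM.HaltsWithin W p (encodeGrammar eT eN g.initial rules)
              (c * (Fintype.card T * g.size + 1)) s ∧
            (s.reg 0 = 1 ↔ g.language ≤ pangrams T) := by
  -- Twice the constant 400 of the program, because a rule occupies `2 + |α|` cells, at most twice
  -- its size `1 + |α|`.
  refine ⟨RAM.decidePangrams, 800, fun T _ g _ eT eN rules hnd hrules W hW => ?_⟩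
  have hext := ContextFreeGrammar.extent_layout_le (eT := eT) (eN := eN) (q := 4) hnd hrules
  have hmul := Nat.mul_le_mul_left (Fintype.card T) hext
  rw [Nat.mul_left_comm] at hmul
  have hlt : ∀ A : g.NT, Fintype.card T + (eN A : ℕ) ≤ W := fun A => by
    have := (eN A).isLt
    omega
  refine (RAM.wp_decidePangrams (i := eN g.initial) (k := Fintype.card T)
    (placed_layout eT eN g.initial rules) (by omega) (hlt _) (fun e he => ?_) rfl ?_ ?_ ?_ ?_
    ?_ |>.mono fun t s h => ⟨?_, ?_⟩).haltsWithin
  · obtain ⟨r, -, hl, -⟩ := exists_rule_of_mem_layout eT eN he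
    exact hl ▸ hlt _
  · funext b; simp [RAM.Store.init]
  · intro b hb b'; simp [RAM.Store.init, hb]
  · simp [encodeGrammar]
  · simp [encodeGrammar]
  · simp [encodeGrammar, length_layout]
  · have := h.1; omega
  · rw [h.2, ContextFreeGrammar.language_le_pangrams_iff hrules]
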